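/- Let $\mathcal G=(V,E,w)$ be a finite simple undirected graph in which every node $i\in V$ carries a flag $w_i\in\{0,1\}$. Write $d_i$ for the degree of $i$ in the current graph and $\bar d(\mathcal G)=\frac1{|V|}\sum_{i\in V} d_i$. The grammar $\Phi^*=\{r_1,r_2,r_3,r_4\}$ allows the following local changes; everything not mentioned stays unchanged. - $r_1$: if $i,j$ are adjacent, $d_i>d_j$, and $h\ne j$ is a neighbour of $i$ that is not adjacent to $j$, then either the edge $ih$ is replaced by the edge $jh$, or, provided $w_i=0$, the edge $jh$ is added, $ih$ is kept, and $w_i$ becomes $1$. - $r_2$: if $i,j$ are adjacent, $h\neq j$ is a neighbour of $i$ that is not adjacent to $j$, and $f\ne i$ is a neighbour of $j$ that is not adjacent to $i$, then the edges $ih$ and $jf$ are replaced by $if$ and $jh$. - $r_3$: if $i,j,h$ form a triangle, $d_i>d_j$ and $w_i=1$, then the edge $ih$ is removed and $w_i$ becomes $0$. - $r_4$: if $i,j$ are adjacent, then they swap the values $w_i$ and $w_j$. A graph can be transformed via $\Phi^*$ into another one if the latter is obtained from it by a finite sequence of such rule applications. Suppose that $\mathcal G$ is connected, that $\bar d(\mathcal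 G)\notin\mathbb N$, that $\sum_{i\in V}w_i>0$, and that $\bar d(\mathcal G)>3$. Then $\mathcal G$ can be transformed via $\Phi^*$ into a graph $\mathcal G'=(V,E',w')$ with $|E'|=|E|-1$. -/

import Mathlib

/-- A labeled graph `(V, E, w)`: a simple undirected graph on `V` together with a binary flag
`w i ∈ {0, 1}` on every node. (The degree part of a node label is determined by the graph.) -/
@[ext]
structure FlaggedGraph (V : Type*) where
  graph : SimpleGraph V
  w : V → Fin 2

namespace FlaggedGraph

variable {V : Type*}

/-- The degree of a node: the number of its neighbours. -/
noncomputable def deg (G : FlaggedGraph V) (i : V) : ℕ :=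
  (G.graph.neighborSet i).ncard

/-- The number of edges `|E|`. -/
noncomputable def numEdges (G : FlaggedGraph V) : ℕ :=
  G.graph.edgeSet.ncard

/-- The average degree. -/
noncomputable def avgDeg [Fintype V] (G : FlaggedGraph V) : ℝ :=
  (∑ i, (G.deg i : ℝ)) / (Fintype.card V : ℝ)

/-- The sum of the flags, `1ᵀ w`. -/
def flagSum [Fintype V] (G : FlaggedGraph V) : ℕ :=
  ∑ i, (G.w i : ℕ)

/-- One application of a rule of the grammar `Φ*`.  Each rule rewrites a small labeled subgraph;
everything else is left unchanged.  Rule `r₁` has two possible outcomes, each of which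
occurs with nonzero probability. -/
inductive Step [DecidableEq V] : FlaggedGraph V → FlaggedGraph V → Prop
  /-- `r₁`, rewiring: `i` and `j` are adjacent, `d_i > d_j`, and `h` is a neighbour of `i` other
  than `j` that is not adjacent to `j`.  The edge `ih` is replaced by `jh`. -/
  | rewire (G : FlaggedGraph V) (i j h : V)
      (hij : G.graph.Adj i j) (hih : G.graph.Adj i h) (hne : h ≠ j)
      (hjh : ¬ G.graph.Adj j h) (hdeg : G.deg j < G.deg i) :
      Step G ⟨G.graph.deleteEdges {s(i, h)} ⊔ SimpleGraph.edge j h, G.w⟩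
  /-- `r₁`, edge addition: as above with, moreover, `w_i = 0`.  The edge `jh` is added, the edge
  `ih` is kept, and the flag of `i` becomes `1`. -/
  | add (G : FlaggedGraph V) (i j h : V)
      (hij : G.graph.Adj i j) (hih : G.graph.Adj i h) (hne : h ≠ j)
      (hjh : ¬ G.graph.Adj j h) (hdeg : G.deg j < G.deg i) (hw : G.w i = 0) :
      Step G ⟨G.graph ⊔ SimpleGraph.edge j h, Function.update G.w i 1⟩
  /-- `r₂`: adjacent nodes `i`, `j` exchange exclusive neighbours `h` (of `i`) and `f` (of `j`). -/
  | exchange (G : FlaggedGraph V) (i j h f : V)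
      (hij : G.graph.Adj i j) (hih : G.graph.Adj i h) (hjf : G.graph.Adj j f)
      (hhj : h ≠ j) (hfi : f ≠ i)
      (hif : ¬ G.graph.Adj i f) (hjh : ¬ G.graph.Adj j h) :
      Step G ⟨G.graph.deleteEdges {s(i, h), s(j, f)} ⊔
        (SimpleGraph.edge i f ⊔ SimpleGraph.edge j h), G.w⟩
  /-- `r₃`: `i`, `j`, `h` form a triangle, `d_i > d_j` and `w_i = 1`.  The edge `ih` is removed
  and the flag of `i` becomes `0`. -/
  | remove (G : FlaggedGraph V) (i j h : V)
      (hij : G.graph.Adj i j) (hih : G.graph.Adj i h) (hjh : G.graph.Adj j h)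
      (hdeg : G.deg j < G.deg i) (hw : G.w i = 1) :
      Step G ⟨G.graph.deleteEdges {s(i, h)}, Function.update G.w i 0⟩
  /-- `r₄`: adjacent nodes `i`, `j` swap their flags. -/
  | swap (G : FlaggedGraph V) (i j : V) (hij : G.graph.Adj i j) :
      Step G ⟨G.graph, G.w ∘ Equiv.swap i j⟩

/-- `G` can be transformed into `G'` via `Φ*`: by a finite sequence of rule applications. -/
def CanTransform [DecidableEq V] (G G' : FlaggedGraph V) : Prop :=
  Relation.ReflTransGen Step G G'

end FlaggedGraph

/-! Rewirings and exchanges preserve the flags, the number of edges and connectivity. Rewirings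
drive down the sum of squared degrees until all degrees differ by at most one
(`Connected.exists_localReach_balanced`). As the average exceeds 3 and is not an integer, all
degrees are then at least 3 and not all are equal. Exchanges shrink a cycle to a triangle without
changing any degree (`Connected.exists_localReach_triangle`), and rewirings carry a differing degree
along a path towards it (`exists_localReach_unequal_of_path`). Once some triangle has two unequal
degrees, a flag is swapped along a path to a vertex of larger degree, and `Step.remove` deletes an
edge. -/

namespace SimpleGraph

variable {V : Type*}

/-! ### Local moves, without flags -/

/-- The degree of a vertex as the cardinality of its neighbour set. -/
noncomputable def ndeg (H : SimpleGraph V) (v : V) : ℕ :=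
  (H.neighborSet v).ncard

/-- The graph in which the edge `ih` is replaced by the edge `jh`. -/
def rewire (H : SimpleGraph V) (i j h : V) : SimpleGraph V :=
  H.deleteEdges {s(i, h)} ⊔ edge j h

/-- The graph in which the edges `ih` and `jf` are replaced by `if` and `jh`. -/
def exchange (H : SimpleGraph V) (i j h f : V) : SimpleGraph V :=
  H.deleteEdges {s(i, h), s(j, f)} ⊔ (edge i f ⊔ edge j h)

/-- A rewiring along an edge towards the endpoint of smaller degree, or a local exchange. -/
inductive LocalMove : SimpleGraph V → SimpleGraph V → Prop
  | rewire (H : SimpleGraph V) (i j h : V) (hij : H.Adj i j) (hih : H.Adj i h) (hne : h ≠ j)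
      (hjh : ¬ H.Adj j h) (hdeg : H.ndeg j < H.ndeg i) : LocalMove H (H.rewire i j h)
  | exchange (H : SimpleGraph V) (i j h f : V) (hij : H.Adj i j) (hih : H.Adj i h)
      (hjf : H.Adj j f) (hhj : h ≠ j) (hfi : f ≠ i) (hif : ¬ H.Adj i f) (hjh : ¬ H.Adj j h) :
      LocalMove H (H.exchange i j h f)

/-- Reachability by a finite sequence of local moves. -/
abbrev LocalReach (H H' : SimpleGraph V) : Prop :=
  Relation.ReflTransGen LocalMove H H'

/-- Some triangle has two vertices of different degrees. -/
def HasUnequalTriangle (H : SimpleGraph V) : Prop :=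
  ∃ i j h, H.Adj i j ∧ H.Adj i h ∧ H.Adj j h ∧ H.ndeg j < H.ndeg i

/-- The vertices `a`, `b`, `c` form a triangle. -/
def IsTriangle (H : SimpleGraph V) (a b c : V) : Prop :=
  H.Adj a b ∧ H.Adj a c ∧ H.Adj b c

lemma rewire_adj {H : SimpleGraph V} {i j h a b : V} :
    (H.rewire i j h).Adj a b ↔
      (H.Adj a b ∧ ¬ (a = i ∧ b = h ∨ a = h ∧ b = i)) ∨
        ((a = j ∧ b = h ∨ a = h ∧ b = j) ∧ a ≠ b) := by
  simp [rewire, edge_adj]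

lemma exchange_adj {H : SimpleGraph V} {i j h f a b : V} :
    (H.exchange i j h f).Adj a b ↔
      (H.Adj a b ∧ ¬ (a = i ∧ b = h ∨ a = h ∧ b = i) ∧ ¬ (a = j ∧ b = f ∨ a = f ∧ b = j)) ∨
        ((a = i ∧ b = f ∨ a = f ∧ b = i) ∧ a ≠ b) ∨
        ((a = j ∧ b = h ∨ a = h ∧ b = j) ∧ a ≠ b) := by
  simp [exchange, edge_adj]

lemma IsTriangle.hasUnequalTriangle {H : SimpleGraph V} {a b c : V} (h : H.IsTriangle a b c)
    (hd : H.ndeg a ≠ H.ndeg b ∨ H.ndeg a ≠ H.ndeg c) : H.HasUnequalTriangle := by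
  obtain ⟨hab, hac, hbc⟩ := h
  rcases hd with hd | hd
  · rcases lt_or_gt_of_ne hd with hd | hd
    · exact ⟨b, a, c, hab.symm, hbc, hac, hd⟩
    · exact ⟨a, b, c, hab, hac, hbc, hd⟩
  · rcases lt_or_gt_of_ne hd with hd | hd
    · exact ⟨c, a, b, hac.symm, hbc.symm, hab, hd⟩
    · exact ⟨a, c, b, hac, hab, hbc.symm, hd⟩

lemma connected_of_adj_reachable {H H' : SimpleGraph V} (hc : H.Connected)
    (h : ∀ a b, H.Adj a b → H'.Reachable a b) : H'.Connected := by
  have := hc.nonempty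
  refine ⟨fun a b => ?_⟩
  obtain ⟨p⟩ := hc.preconnected a b
  induction p with
  | nil => exact .rfl
  | cons hab _ ih => exact (h _ _ hab).trans ih

/-- The edge `ij` survives, so a lost edge `ih` is bypassed by `i, j, h` and a lost edge `jf` by `j,
i, f`. -/
lemma LocalMove.connected {H H' : SimpleGraph V} (hm : LocalMove H H') (hc : H.Connected) :
    H'.Connected := by
  refine connected_of_adj_reachable hc fun a b hab => ?_
  cases hm with
  | rewire i j h hij hih hne hjh hdeg =>
    have h1 : (H.rewire i j h).Adj i j := rewire_adj.2 (Or.inl ⟨hij, by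
      have := hij.ne
      grind⟩)
    have h2 : (H.rewire i j h).Adj j h := rewire_adj.2 (Or.inr (by grind))
    by_cases he : a = i ∧ b = h ∨ a = h ∧ b = i
    · rcases he with ⟨rfl, rfl⟩ | ⟨rfl, rfl⟩
      · exact h1.reachable.trans h2.reachable
      · exact (h1.reachable.trans h2.reachable).symm
    · exact (rewire_adj.2 (Or.inl ⟨hab, he⟩)).reachable
  | exchange i j h f hij hih hjf hhj hfi hif hjh =>
    have := hij.ne
    have h1 : (H.exchange i j h f).Adj i j := exchange_adj.2 (Or.inl ⟨hij, by grind⟩)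
    have h2 : (H.exchange i j h f).Adj j h := exchange_adj.2 (Or.inr (by grind))
    have h3 : (H.exchange i j h f).Adj i f := exchange_adj.2 (Or.inr (by grind))
    by_cases he : a = i ∧ b = h ∨ a = h ∧ b = i
    · rcases he with ⟨rfl, rfl⟩ | ⟨rfl, rfl⟩
      · exact h1.reachable.trans h2.reachable
      · exact (h1.reachable.trans h2.reachable).symm
    · by_cases he' : a = j ∧ b = f ∨ a = f ∧ b = j
      · rcases he' with ⟨rfl, rfl⟩ | ⟨rfl, rfl⟩
        · exact h1.symm.reachable.trans h3.reachable
        · exact (h1.symm.reachable.trans h3.reachable).symm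
      · exact (exchange_adj.2 (Or.inl ⟨hab, he, he'⟩)).reachable

lemma LocalReach.connected {H H' : SimpleGraph V} (hm : LocalReach H H') (hc : H.Connected) :
    H'.Connected := by
  induction hm with
  | refl => exact hc
  | tail _ h ih => exact h.connected ih

/-! ### Degrees under local moves -/

lemma ndeg_rewire_source [Finite V] {H : SimpleGraph V} {i j h : V} (hij : H.Adj i j) (hih : H.Adj i h) :
    (H.rewire i j h).ndeg i + 1 = H.ndeg i := by
  have : (H.rewire i j h).neighborSet i = H.neighborSet i \ {h} := by
    ext b
    have := hij.ne
    have := hih.ne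
    simp only [mem_neighborSet, rewire_adj, Set.mem_sdiff, Set.mem_singleton_iff]
    grind
  rw [ndeg, ndeg, this]
  exact Set.ncard_sdiff_singleton_add_one hih (Set.toFinite _)

lemma ndeg_rewire_target [Finite V] {H : SimpleGraph V} {i j h : V} (hij : H.Adj i j) (hne : h ≠ j)
    (hjh : ¬ H.Adj j h) : (H.rewire i j h).ndeg j = H.ndeg j + 1 := by
  have : (H.rewire i j h).neighborSet j = insert h (H.neighborSet j) := by
    ext b
    have := hij.ne
    simp only [mem_neighborSet, rewire_adj, Set.mem_insert_iff]
    grind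
  rw [ndeg, ndeg, this]
  exact Set.ncard_insert_of_notMem hjh (Set.toFinite _)

lemma ndeg_rewire_of_ne {H : SimpleGraph V} {i j h v : V} (hih : H.Adj i h) (hne : h ≠ j)
    (hjh : ¬ H.Adj j h) (hvi : v ≠ i) (hvj : v ≠ j) : (H.rewire i j h).ndeg v = H.ndeg v := by
  by_cases hv : v = h
  · subst hv
    have : (H.rewire i j v).neighborSet v = insert j (H.neighborSet v \ {i}) := by
      ext b
      simp only [mem_neighborSet, rewire_adj, Set.mem_insert_iff, Set.mem_sdiff,
        Set.mem_singleton_iff]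
      grind
    rw [ndeg, ndeg, this]
    exact Set.ncard_exchange (fun h => hjh h.symm) hih.symm
  · have : (H.rewire i j h).neighborSet v = H.neighborSet v := by
      ext b
      simp only [mem_neighborSet, rewire_adj]
      grind
    rw [ndeg, ndeg, this]

lemma ndeg_exchange {H : SimpleGraph V} {i j h f : V} (hij : H.Adj i j) (hih : H.Adj i h)
    (hjf : H.Adj j f) (hhj : h ≠ j) (hfi : f ≠ i) (hif : ¬ H.Adj i f) (hjh : ¬ H.Adj j h) (v : V) :
    (H.exchange i j h f).ndeg v = H.ndeg v := by
  have hfh : f ≠ h := by rintro rfl; exact hif hih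
  have h1 := hij.ne
  have h2 := hih.ne
  have h3 := hjf.ne
  have key : ∀ x y, ¬ H.Adj v x → H.Adj v y →
      (H.exchange i j h f).neighborSet v = insert x (H.neighborSet v \ {y}) →
      (H.exchange i j h f).ndeg v = H.ndeg v := by
    intro x y hx hy he
    rw [ndeg, ndeg, he]
    exact Set.ncard_exchange hx hy
  by_cases hvi : v = i
  · subst hvi
    refine key f h hif hih (Set.ext fun b => ?_)
    simp only [mem_neighborSet, exchange_adj, Set.mem_insert_iff, Set.mem_sdiff,
      Set.mem_singleton_iff]
    grind
  by_cases hvj : v = j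
  · subst hvj
    refine key h f hjh hjf (Set.ext fun b => ?_)
    simp only [mem_neighborSet, exchange_adj, Set.mem_insert_iff, Set.mem_sdiff,
      Set.mem_singleton_iff]
    grind
  by_cases hvh : v = h
  · subst hvh
    refine key j i (fun h => hjh h.symm) hih.symm (Set.ext fun b => ?_)
    simp only [mem_neighborSet, exchange_adj, Set.mem_insert_iff, Set.mem_sdiff,
      Set.mem_singleton_iff]
    grind
  by_cases hvf : v = f
  · subst hvf
    refine key i j (fun h => hif h.symm) hjf.symm (Set.ext fun b => ?_)
    simp only [mem_neighborSet, exchange_adj, Set.mem_insert_iff, Set.mem_sdiff,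
      Set.mem_singleton_iff]
    grind
  have : (H.exchange i j h f).neighborSet v = H.neighborSet v := by
    ext b
    simp only [mem_neighborSet, exchange_adj]
    grind
  rw [ndeg, ndeg, this]

lemma sum_ndeg [Fintype V] (H : SimpleGraph V) : ∑ v, H.ndeg v = 2 * H.edgeSet.ncard := by
  classical
  have h := H.sum_degrees_eq_twice_card_edges
  rw [← Set.ncard_coe_finset, coe_edgeFinset] at h
  rw [← h]
  refine Finset.sum_congr rfl fun v _ => ?_
  rw [ndeg, ← card_neighborSet_eq_degree, Set.ncard_eq_toFinset_card', Set.toFinset_card]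

/-- Only the degrees of `i` and `j` change. Taking `g = id` gives invariance of the degree sum;
squaring gives the balancing potential. -/
lemma sum_comp_ndeg_rewire [Fintype V] {H : SimpleGraph V} {i j h : V} (hij : H.Adj i j)
    (hih : H.Adj i h) (hne : h ≠ j) (hjh : ¬ H.Adj j h) (g : ℕ → ℕ) :
    ∑ v, g ((H.rewire i j h).ndeg v) + (g (H.ndeg i) + g (H.ndeg j)) =
      ∑ v, g (H.ndeg v) + (g ((H.rewire i j h).ndeg i) + g ((H.rewire i j h).ndeg j)) := by
  classical
  have hji : j ∈ Finset.univ.erase i := by simp [hij.ne']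
  rw [← Finset.add_sum_erase _ _ (Finset.mem_univ i), ← Finset.add_sum_erase _ _ hji,
    ← Finset.add_sum_erase (f := fun v => g (H.ndeg v)) _ (Finset.mem_univ i),
    ← Finset.add_sum_erase (f := fun v => g (H.ndeg v)) _ hji]
  have : ∑ x ∈ (Finset.univ.erase i).erase j, g ((H.rewire i j h).ndeg x) =
      ∑ x ∈ (Finset.univ.erase i).erase j, g (H.ndeg x) :=
    Finset.sum_congr rfl fun v hv => by
      rw [ndeg_rewire_of_ne hih hne hjh (by grind) (by grind)]
  omega

lemma LocalMove.sum_ndeg_eq [Fintype V] {H H' : SimpleGraph V} (hm : LocalMove H H') :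
    ∑ v, H'.ndeg v = ∑ v, H.ndeg v := by
  cases hm with
  | rewire i j h hij hih hne hjh hdeg =>
    have h1 := sum_comp_ndeg_rewire hij hih hne hjh id
    have h2 := ndeg_rewire_source hij hih
    have h3 := ndeg_rewire_target hij hne hjh
    simp only [id] at h1
    omega
  | exchange i j h f hij hih hjf hhj hfi hif hjh =>
    exact Finset.sum_congr rfl fun v _ => ndeg_exchange hij hih hjf hhj hfi hif hjh v

lemma LocalReach.sum_ndeg_eq [Fintype V] {H H' : SimpleGraph V} (hm : LocalReach H H') :
    ∑ v, H'.ndeg v = ∑ v, H.ndeg v := by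
  induction hm with
  | refl => rfl
  | tail _ h ih => exact h.sum_ndeg_eq.trans ih

/-! ### Choosing neighbours and transporting paths -/

lemma exists_adj_notMem [Finite V] {H : SimpleGraph V} {x : V} {S : Finset V} (hS : S.card < H.ndeg x) :
    ∃ y, H.Adj x y ∧ y ∉ S := by
  by_contra! hcon
  have : H.neighborSet x ⊆ (S : Set V) := fun y hy => hcon y hy
  have := Set.ncard_le_ncard this (Set.toFinite _)
  rw [Set.ncard_coe_finset] at this
  exact absurd hS (not_lt.2 this)

lemma exists_exclusive_neighbor [Finite V] {H : SimpleGraph V} {i j : V} (hij : H.Adj i j)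
    (hd : H.ndeg j < H.ndeg i) : ∃ h, H.Adj i h ∧ h ≠ j ∧ ¬ H.Adj j h := by
  by_contra! hcon
  have hsub : H.neighborSet i \ {j} ⊆ H.neighborSet j \ {i} := fun y hy =>
    ⟨hcon y hy.1 hy.2, fun h => (H.ne_of_adj hy.1) h.symm⟩
  have h0 := Set.ncard_le_ncard hsub (Set.toFinite _)
  have h1 : (H.neighborSet i \ {j}).ncard + 1 = H.ndeg i :=
    Set.ncard_sdiff_singleton_add_one hij (Set.toFinite _)
  have h2 : (H.neighborSet j \ {i}).ncard + 1 = H.ndeg j :=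
    Set.ncard_sdiff_singleton_add_one hij.symm (Set.toFinite _)
  omega

lemma Walk.IsPath.exists_isPath_of_support {H H' : SimpleGraph V} {a b : V} {p : H.Walk a b}
    (hp : p.IsPath) (h : ∀ x ∈ p.support, ∀ y ∈ p.support, H.Adj x y → H'.Adj x y) :
    ∃ q : H'.Walk a b, q.IsPath ∧ q.length = p.length ∧ q.support = p.support := by
  have he : ∀ e ∈ p.edges, e ∈ H'.edgeSet := by
    intro e he
    induction e with
    | _ x y =>
      exact h x (p.fst_mem_support_of_mem_edges he) y (p.snd_mem_support_of_mem_edges he)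
        (p.adj_of_mem_edges he)
  exact ⟨p.transfer H' he, hp.transfer he, Walk.length_transfer _ _, Walk.support_transfer _ _⟩

end SimpleGraph

/-! ### Balancing the degrees -/

namespace SimpleGraph

variable {V : Type*}

/-- Rewiring along the first edge of the path either lowers the sum of squares or, when the degrees
differ by one, swaps them; the excess then sits one step closer to `v`. -/
lemma exists_localReach_sum_sq_lt [Fintype V] (k : ℕ) :
    ∀ (H : SimpleGraph V) (u v : V) (p : H.Walk u v), p.IsPath → p.length = k →
      H.ndeg v + 2 ≤ H.ndeg u →
      ∃ H', LocalReach H H' ∧ ∑ x, H'.ndeg x ^ 2 < ∑ x, H.ndeg x ^ 2 := by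
  induction k with
  | zero =>
    intro H u v p _ hk hd
    obtain rfl := Walk.eq_of_length_eq_zero hk
    omega
  | succ k ih =>
    intro H u v p hp hk hd
    cases p with
    | nil => omega
    | @cons _ x _ hux q =>
      rw [Walk.cons_isPath_iff] at hp
      rw [Walk.length_cons, add_left_inj] at hk
      by_cases hx : H.ndeg v + 2 ≤ H.ndeg x
      · exact ih H x v q hp.1 hk hx
      have hlt : H.ndeg x < H.ndeg u := by omega
      obtain ⟨h, huh, hhx, hxh⟩ := exists_exclusive_neighbor hux hlt
      have hmove := LocalMove.rewire H u x h hux huh hhx hxh hlt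
      have hs := ndeg_rewire_source hux huh
      have ht := ndeg_rewire_target hux hhx hxh
      have hsum := sum_comp_ndeg_rewire hux huh hhx hxh (· ^ 2)
      simp only [← hs, ht] at hsum
      by_cases hx2 : H.ndeg x + 2 ≤ H.ndeg u
      · exact ⟨_, .single hmove, by nlinarith⟩
      have hux' : (H.rewire u x h).ndeg u = H.ndeg x := by omega
      rw [hux'] at hsum
      have hvu : v ≠ u := by rintro rfl; omega
      have hvx : v ≠ x := by rintro rfl; omega
      have hv := ndeg_rewire_of_ne huh hhx hxh hvu hvx
      -- The deleted edge contains `u`, which is not on the rest of the path.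
      obtain ⟨q', hq', hl, -⟩ := hp.1.exists_isPath_of_support (H' := H.rewire u x h)
        fun a ha b hb hab => rewire_adj.2 (Or.inl ⟨hab, by grind⟩)
      obtain ⟨H', hr, hlt'⟩ := ih _ x v q' hq' (hl.trans hk) (by omega)
      exact ⟨H', .head hmove hr, by omega⟩

lemma Connected.exists_localReach_balanced [Fintype V] {H : SimpleGraph V} (hc : H.Connected) :
    ∃ H', LocalReach H H' ∧ ∀ u v, H'.ndeg u ≤ H'.ndeg v + 1 := by
  induction hn : ∑ x, H.ndeg x ^ 2 using Nat.strong_induction_on generalizing H with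
  | _ n ih =>
    by_cases hb : ∀ u v, H.ndeg u ≤ H.ndeg v + 1
    · exact ⟨H, .refl, hb⟩
    push Not at hb
    obtain ⟨u, v, huv⟩ := hb
    obtain ⟨p, hp⟩ := (hc.preconnected u v).exists_isPath
    obtain ⟨H₁, hr, hlt⟩ := exists_localReach_sum_sq_lt _ H u v p hp rfl huv
    obtain ⟨H₂, hr₂, hb₂⟩ := ih _ (hn ▸ hlt) (hr.connected hc) rfl
    exact ⟨H₂, hr.trans hr₂, hb₂⟩

/-! ### Creating a triangle -/

/-- A cycle, given as a path whose endpoints are adjacent, can be shrunk to a triangle by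
exchanges when all degrees are at least three. -/
lemma exists_localReach_triangle_of_path [Finite V] (k : ℕ) :
    ∀ (H : SimpleGraph V) (u v : V) (p : H.Walk u v), p.IsPath → p.length = k + 2 → H.Adj u v →
      (∀ x, 3 ≤ H.ndeg x) →
      ∃ H', LocalReach H H' ∧ (∀ x, H'.ndeg x = H.ndeg x) ∧ ∃ a b c, H'.IsTriangle a b c := by
  classical
  induction k with
  | zero =>
    intro H u v p hp hk huv _
    match p, hk with
    | .cons (v := x) hux (.cons hxv .nil), _ =>
      exact ⟨H, .refl, fun _ => rfl, u, x, v, hux, huv, hxv⟩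
  | succ k ih =>
    intro H u v p hp hk huv hd
    by_cases htri : ∃ a b c, H.IsTriangle a b c
    · exact ⟨H, .refl, fun _ => rfl, htri⟩
    match p, hk with
    | .cons (v := x) hux (.cons (v := y) hxy q), hk =>
      simp only [Walk.cons_isPath_iff, Walk.support_cons, List.mem_cons, not_or] at hp
      obtain ⟨⟨hq, hxq⟩, hux', huq⟩ := hp
      have hq1 : q.length = k + 1 := by simpa using hk
      -- Avoiding `v` keeps the closing edge `uv`. Without triangles, `h` and `y` are exclusive
      -- neighbours, and the exchange creates the chord `uy`, which cuts `x` out of the cycle.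
      have hcard : ({x, v} : Finset V).card < H.ndeg u := (Finset.card_le_two).trans_lt (hd u)
      obtain ⟨h, huh, hh⟩ := exists_adj_notMem hcard
      simp only [Finset.mem_insert, Finset.mem_singleton, not_or] at hh
      have hvq : v ∈ q.support := q.end_mem_support
      have hyq : y ∈ q.support := q.start_mem_support
      have hyu : y ≠ u := by rintro rfl; exact huq hyq
      have huy : ¬ H.Adj u y := fun h => htri ⟨u, x, y, hux, h, hxy⟩
      have hxh : ¬ H.Adj x h := fun h' => htri ⟨u, x, h, hux, huh, h'⟩
      have hmove := LocalMove.exchange H u x h y hux huh hxy hh.1 hyu huy hxh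
      have hdeg := ndeg_exchange hux huh hxy hh.1 hyu huy hxh
      obtain ⟨q', hq', hl, hs⟩ := hq.exists_isPath_of_support (H' := H.exchange u x h y)
        fun a ha b hb hab => exchange_adj.2 (Or.inl ⟨hab, by grind⟩)
      have huy' : (H.exchange u x h y).Adj u y := exchange_adj.2 (Or.inr (by grind))
      have huv' : (H.exchange u x h y).Adj u v := exchange_adj.2 (Or.inl ⟨huv, by grind⟩)
      obtain ⟨H', hr, hd', ht⟩ := ih _ u v (.cons huy' q')
        (by rw [Walk.cons_isPath_iff, hs]; exact ⟨hq', huq⟩)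
        (by rw [Walk.length_cons, hl, hq1]) huv' (fun z => (hdeg z).symm ▸ hd z)
      exact ⟨H', .head hmove hr, fun z => (hd' z).trans (hdeg z), ht⟩

/-- Otherwise the graph is a tree, whose degree sum is less than twice the number of vertices. -/
lemma Connected.exists_isCycle [Fintype V] {H : SimpleGraph V} (hc : H.Connected)
    (hd : ∀ x, 2 ≤ H.ndeg x) : ∃ (u : V) (c : H.Walk u u), c.IsCycle := by
  classical
  by_contra! hcon
  have htree : H.IsTree := ⟨hc, fun u c => hcon u c⟩
  have h1 := htree.card_edgeFinset
  rw [← Set.ncard_coe_finset, coe_edgeFinset] at h1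
  have h2 := H.sum_ndeg
  have h3 : ∑ _v : V, 2 ≤ ∑ v, H.ndeg v := Finset.sum_le_sum fun v _ => hd v
  rw [Finset.sum_const, Finset.card_univ, smul_eq_mul] at h3
  omega

lemma Connected.exists_localReach_triangle [Fintype V] {H : SimpleGraph V} (hc : H.Connected)
    (hd : ∀ x, 3 ≤ H.ndeg x) :
    ∃ H', LocalReach H H' ∧ (∀ x, H'.ndeg x = H.ndeg x) ∧ ∃ a b c, H'.IsTriangle a b c := by
  obtain ⟨u, c, hcyc⟩ := hc.exists_isCycle fun x => (Nat.le_succ 2).trans (hd x)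
  have hlen := hcyc.three_le_length
  cases c with
  | nil => simp at hlen
  | cons h p =>
    rw [Walk.cons_isCycle_iff] at hcyc
    rw [Walk.length_cons] at hlen
    exact exists_localReach_triangle_of_path (p.length - 2) H _ _ p hcyc.1 (by omega) h.symm hd

/-! ### Making a triangle's degrees unequal -/

/-- A light vertex adjacent to a heavy triangle can be exploited directly. -/
lemma exists_localReach_unequal_of_adj_heavy [Finite V] {H : SimpleGraph V} {u a b c : V}
    (hT : H.IsTriangle a b c) (hua : H.Adj u a) (hd : H.ndeg a = H.ndeg u + 1)
    (hb : H.ndeg b = H.ndeg a) (h3 : 3 ≤ H.ndeg u) :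
    ∃ H', LocalReach H H' ∧ H'.HasUnequalTriangle := by
  classical
  by_cases hcom : ∃ z, H.Adj u z ∧ H.Adj a z
  · obtain ⟨z, huz, haz⟩ := hcom
    exact ⟨H, .refl, a, u, z, hua.symm, haz, huz, by omega⟩
  -- Here `a` has degree at least 4, so it can give up an edge outside the triangle; its degree then
  -- drops below that of `b`.
  have hcard : ({u, b, c} : Finset V).card < H.ndeg a :=
    Finset.card_le_three.trans_lt (by omega)
  obtain ⟨h, hah, hh⟩ := exists_adj_notMem hcard
  simp only [Finset.mem_insert, Finset.mem_singleton, not_or] at hh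
  have huh : ¬ H.Adj u h := fun h' => hcom ⟨h, h', hah⟩
  have hmove := LocalMove.rewire H a u h hua.symm hah hh.1 huh (by omega)
  have hs := ndeg_rewire_source hua.symm hah
  obtain ⟨hab, hac, hbc⟩ := hT
  have hbd := ndeg_rewire_of_ne (v := b) hah hh.1 huh hab.ne' (by rintro rfl; omega)
  have := hab.ne
  have := hac.ne
  have hT' : (H.rewire a u h).IsTriangle a b c :=
    ⟨rewire_adj.2 (Or.inl ⟨hab, by grind⟩), rewire_adj.2 (Or.inl ⟨hac, by grind⟩),
      rewire_adj.2 (Or.inl ⟨hbc, by grind⟩)⟩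
  exact ⟨_, .single hmove, hT'.hasUnequalTriangle (Or.inl (by omega))⟩

/-- By balance, rewiring between `u` and a neighbour with the degree of `a` swaps their two degrees,
so the discrepancy moves one step towards the triangle. The set of degree values does not grow, so
the balance and the lower bound persist. -/
lemma exists_localReach_unequal_of_path [Finite V] (k : ℕ) :
    ∀ (H : SimpleGraph V) (u a b c : V) (p : H.Walk u a), p.IsPath → p.length = k →
      H.IsTriangle a b c → H.ndeg u ≠ H.ndeg a → (∀ x y, H.ndeg x ≤ H.ndeg y + 1) →
      (∀ x, 3 ≤ H.ndeg x) → ∃ H', LocalReach H H' ∧ H'.HasUnequalTriangle := by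
  classical
  induction k with
  | zero =>
    intro H u a b c p _ hk _ hd
    exact absurd (congrArg _ (Walk.eq_of_length_eq_zero hk)) hd
  | succ k ih =>
    intro H u a b c p hp hk hT hd hbal h3
    by_cases heq : H.ndeg a ≠ H.ndeg b ∨ H.ndeg a ≠ H.ndeg c
    · exact ⟨H, .refl, hT.hasUnequalTriangle heq⟩
    push Not at heq
    obtain ⟨hb, hc⟩ := heq
    have hua : u ≠ a := by rintro rfl; exact hd rfl
    have hub : u ≠ b := by rintro rfl; exact hd hb.symm
    have huc : u ≠ c := by rintro rfl; exact hd hc.symm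
    cases p with
    | nil => exact absurd rfl hua
    | @cons _ x _ hux q =>
      rw [Walk.cons_isPath_iff] at hp
      rw [Walk.length_cons, add_left_inj] at hk
      obtain ⟨hq, huq⟩ := hp
      by_cases hx : H.ndeg x = H.ndeg a
      swap
      · exact ih H x a b c q hq hk hT hx hbal h3
      rcases lt_or_gt_of_ne hd with hlt | hlt
      · have hda : H.ndeg a = H.ndeg u + 1 := by have := hbal a u; omega
        by_cases hxa : x = a
        · subst hxa
          exact exists_localReach_unequal_of_adj_heavy hT hux hda hb.symm (h3 u)
        by_cases hxb : x = b
        · subst hxb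
          exact exists_localReach_unequal_of_adj_heavy (b := a) (c := c)
            ⟨hT.1.symm, hT.2.2, hT.2.1⟩ hux (by omega) hb (h3 u)
        by_cases hxc : x = c
        · subst hxc
          exact exists_localReach_unequal_of_adj_heavy (b := a) (c := b)
            ⟨hT.2.1.symm, hT.2.2.symm, hT.1⟩ hux (by omega) hc (h3 u)
        by_cases hcom : ∃ z, H.Adj u z ∧ H.Adj x z
        · obtain ⟨z, huz, hxz⟩ := hcom
          exact ⟨H, .refl, x, u, z, hux.symm, hxz, huz, by omega⟩
        cases q with
        | nil => exact absurd rfl hxa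
        | @cons _ y _ hxy r =>
          -- Here `x` gives up an edge, and excluding `y` keeps the rest of the path.
          have hcard : ({u, y} : Finset V).card < H.ndeg x :=
            Finset.card_le_two.trans_lt (by have := h3 u; omega)
          obtain ⟨h, hxh, hh⟩ := exists_adj_notMem hcard
          simp only [Finset.mem_insert, Finset.mem_singleton, not_or] at hh
          have huh : ¬ H.Adj u h := fun h' => hcom ⟨h, h', hxh⟩
          have hmove := LocalMove.rewire H x u h hux.symm hxh hh.1 huh (by omega)
          have hs := ndeg_rewire_source hux.symm hxh
          have ht := ndeg_rewire_target hux.symm hh.1 huh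
          have ho := fun v => ndeg_rewire_of_ne (v := v) hxh hh.1 huh
          rw [Walk.cons_isPath_iff] at hq
          obtain ⟨r', hr', hl, hsup⟩ := hq.1.exists_isPath_of_support (H' := H.rewire x u h)
            fun d hd e he hde => rewire_adj.2 (Or.inl ⟨hde, by grind⟩)
          have hxy' : (H.rewire x u h).Adj x y := rewire_adj.2 (Or.inl ⟨hxy, by grind⟩)
          have hT' : (H.rewire x u h).IsTriangle a b c :=
            ⟨rewire_adj.2 (Or.inl ⟨hT.1, by grind⟩), rewire_adj.2 (Or.inl ⟨hT.2.1, by grind⟩),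
              rewire_adj.2 (Or.inl ⟨hT.2.2, by grind⟩)⟩
          have hda' := ho a (Ne.symm hxa) hua.symm
          have hperm : ∀ v, ∃ w, (H.rewire x u h).ndeg v = H.ndeg w := fun v => by
            by_cases hvx : v = x
            · exact ⟨u, by subst hvx; omega⟩
            by_cases hvu : v = u
            · exact ⟨x, by subst hvu; omega⟩
            exact ⟨v, ho v hvx hvu⟩
          obtain ⟨H', hr, hu⟩ := ih _ x a b c (.cons hxy' r')
            (by rw [Walk.cons_isPath_iff, hsup]; exact ⟨hr', hq.2⟩)
            (by rw [Walk.length_cons, hl, ← hk, Walk.length_cons]) hT' (by omega)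
            (fun v w => by
              obtain ⟨v', hv⟩ := hperm v
              obtain ⟨w', hw⟩ := hperm w
              rw [hv, hw]; exact hbal v' w')
            (fun v => by obtain ⟨v', hv⟩ := hperm v; rw [hv]; exact h3 v')
          exact ⟨H', .head hmove hr, hu⟩
      · have hda : H.ndeg u = H.ndeg a + 1 := by have := hbal u a; omega
        have hxu : H.ndeg x < H.ndeg u := by omega
        obtain ⟨h, huh, hhx, hxh⟩ := exists_exclusive_neighbor hux hxu
        have hmove := LocalMove.rewire H u x h hux huh hhx hxh hxu
        have hs := ndeg_rewire_source hux huh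
        have ht := ndeg_rewire_target hux hhx hxh
        have ho := fun v => ndeg_rewire_of_ne (v := v) huh hhx hxh
        have hT' : (H.rewire u x h).IsTriangle a b c :=
          ⟨rewire_adj.2 (Or.inl ⟨hT.1, by grind⟩), rewire_adj.2 (Or.inl ⟨hT.2.1, by grind⟩),
            rewire_adj.2 (Or.inl ⟨hT.2.2, by grind⟩)⟩
        -- The cases `x = b` and `x = c` need no separate treatment: the degree of `x` then differs
        -- from that of `a`, which the next call detects at once.
        by_cases hxa : x = a
        · subst hxa
          have := ho b hub.symm hT.1.ne'
          exact ⟨_, .single hmove, hT'.hasUnequalTriangle (Or.inl (by omega))⟩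
        obtain ⟨q', hq', hl, -⟩ := hq.exists_isPath_of_support (H' := H.rewire u x h)
          fun d hd e he hde => rewire_adj.2 (Or.inl ⟨hde, by grind⟩)
        have hda' := ho a hua.symm (Ne.symm hxa)
        have hperm : ∀ v, ∃ w, (H.rewire u x h).ndeg v = H.ndeg w := fun v => by
          by_cases hvx : v = x
          · exact ⟨u, by subst hvx; omega⟩
          by_cases hvu : v = u
          · exact ⟨x, by subst hvu; omega⟩
          exact ⟨v, ho v hvu hvx⟩
        obtain ⟨H', hr, hu⟩ := ih _ x a b c q' hq' (hl.trans hk) hT' (by omega)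
          (fun v w => by
            obtain ⟨v', hv⟩ := hperm v
            obtain ⟨w', hw⟩ := hperm w
            rw [hv, hw]; exact hbal v' w')
          (fun v => by obtain ⟨v', hv⟩ := hperm v; rw [hv]; exact h3 v')
        exact ⟨H', .head hmove hr, hu⟩

/-- A connected nonregular graph whose degrees are at least three and differ by at most one can be
moved to a graph with a triangle of nonconstant degree. -/
lemma Connected.exists_localReach_unequal [Fintype V] {H : SimpleGraph V} (hc : H.Connected)
    (h3 : ∀ x, 3 ≤ H.ndeg x) (hbal : ∀ x y, H.ndeg x ≤ H.ndeg y + 1)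
    (hreg : ∀ m, ∃ x, H.ndeg x ≠ m) : ∃ H', LocalReach H H' ∧ H'.HasUnequalTriangle := by
  obtain ⟨H₁, hr, hd, a, b, c, hT⟩ := hc.exists_localReach_triangle h3
  obtain ⟨u, hu⟩ := hreg (H.ndeg a)
  obtain ⟨p, hp⟩ := ((hr.connected hc).preconnected u a).exists_isPath
  obtain ⟨H₂, hr₂, hu₂⟩ := exists_localReach_unequal_of_path _ H₁ u a b c p hp rfl hT
    (by rwa [hd, hd]) (by simpa only [hd] using hbal) (by simpa only [hd] using h3)
  exact ⟨H₂, hr.trans hr₂, hu₂⟩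

end SimpleGraph

/-! ### Moving a flag and removing an edge -/

namespace FlaggedGraph

variable {V : Type*} [DecidableEq V]

lemma canTransform_of_localReach {H H' : SimpleGraph V} (hr : H.LocalReach H') (w : V → Fin 2) :
    CanTransform ⟨H, w⟩ ⟨H', w⟩ := by
  induction hr with
  | refl => exact .refl
  | tail _ hm ih =>
    refine ih.tail ?_
    cases hm with
    | rewire i j h hij hih hne hjh hdeg => exact Step.rewire ⟨_, w⟩ i j h hij hih hne hjh hdeg
    | exchange i j h f hij hih hjf hhj hfi hif hjh =>
      exact Step.exchange ⟨_, w⟩ i j h f hij hih hjf hhj hfi hif hjh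

lemma exists_canTransform_flag {H : SimpleGraph V} {u v : V} (p : H.Walk u v) (w : V → Fin 2)
    (hw : w u = 1) : ∃ w' : V → Fin 2, CanTransform ⟨H, w⟩ ⟨H, w'⟩ ∧ w' v = 1 := by
  induction p generalizing w with
  | nil => exact ⟨w, .refl, hw⟩
  | @cons u x v hux q ih =>
    obtain ⟨w', hr, hw'⟩ := ih (w ∘ Equiv.swap u x) (by simpa using hw)
    exact ⟨w', .head (Step.swap ⟨H, w⟩ u x hux) hr, hw'⟩

lemma exists_canTransform_remove {H : SimpleGraph V} (hc : H.Connected)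
    (hT : H.HasUnequalTriangle) {w : V → Fin 2} {v : V} (hw : w v = 1) :
    ∃ G' : FlaggedGraph V, CanTransform ⟨H, w⟩ G' ∧ ∃ e ∈ H.edgeSet,
      G'.graph.edgeSet = H.edgeSet \ {e} := by
  obtain ⟨i, j, h, hij, hih, hjh, hd⟩ := hT
  obtain ⟨p⟩ := hc.preconnected v i
  obtain ⟨w', hr, hw'⟩ := exists_canTransform_flag p w hw
  exact ⟨_, hr.tail (Step.remove ⟨H, w'⟩ i j h hij hih hjh hd hw'), s(i, h), hih,
    SimpleGraph.edgeSet_deleteEdges _⟩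

end FlaggedGraph

theorem mainTheorem8 {V : Type*} [Fintype V] [DecidableEq V] (G : FlaggedGraph V)
    (hconn : G.graph.Connected)
    (hnonint : ∀ m : ℕ, G.avgDeg ≠ (m : ℝ))
    (hflag : 0 < G.flagSum)
    (hdeg : 3 < G.avgDeg) :
    ∃ G' : FlaggedGraph V, G.CanTransform G' ∧ G'.numEdges + 1 = G.numEdges := by
  obtain ⟨H, hr, hbal⟩ := hconn.exists_localReach_balanced
  have hcard : (0 : ℝ) < Fintype.card V := by
    have := hconn.nonempty
    exact_mod_cast Fintype.card_pos
  have havg : G.avgDeg = ((∑ v, H.ndeg v : ℕ) : ℝ) / (Fintype.card V : ℝ) := by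
    rw [hr.sum_ndeg_eq]
    simp only [FlaggedGraph.avgDeg, FlaggedGraph.deg, SimpleGraph.ndeg, Nat.cast_sum]
  have h3 : ∀ x, 3 ≤ H.ndeg x := by
    intro x
    by_contra! hx
    -- By balance, one degree of at most 2 would force all degrees to be at most 3.
    have hle : ∑ v, H.ndeg v ≤ ∑ _v : V, 3 :=
      Finset.sum_le_sum fun v _ => by have := hbal v x; omega
    rw [Finset.sum_const, Finset.card_univ, smul_eq_mul] at hle
    rw [havg, lt_div_iff₀ hcard] at hdeg
    have : Fintype.card V * 3 < Fintype.card V * 3 := by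
      refine lt_of_lt_of_le ?_ hle
      rw [mul_comm]
      exact_mod_cast hdeg
    exact lt_irrefl _ this
  have hreg : ∀ m, ∃ x, H.ndeg x ≠ m := by
    intro m
    by_contra! hm
    refine hnonint m ?_
    rw [havg, div_eq_iff hcard.ne', Finset.sum_congr rfl fun v _ => hm v]
    simp [mul_comm]
  obtain ⟨H', hr', hT⟩ := (hr.connected hconn).exists_localReach_unequal h3 hbal hreg
  obtain ⟨v, hv⟩ : ∃ v, G.w v = 1 := by
    by_contra! hcon
    have hz : ∀ v, G.w v = 0 := fun v => by have := hcon v; omega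
    simp [FlaggedGraph.flagSum, hz] at hflag
  have hreach : G.graph.LocalReach H' := hr.trans hr'
  obtain ⟨G', hG', e, he, hE⟩ :=
    FlaggedGraph.exists_canTransform_remove (hreach.connected hconn) hT hv
  refine ⟨G', (FlaggedGraph.canTransform_of_localReach hreach G.w).trans hG', ?_⟩
  have hsum := hreach.sum_ndeg_eq
  rw [SimpleGraph.sum_ndeg, SimpleGraph.sum_ndeg] at hsum
  rw [FlaggedGraph.numEdges, FlaggedGraph.numEdges, hE,
    Set.ncard_sdiff_singleton_add_one he (Set.toFinite _)]
  omega
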